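/- **Conventions.** A *value map* on a commutative ring $T$ is a map $v:T\to\mathbb R\cup\{\infty\}$ with $v(ab)=v(a)+v(b)$, $v(a+b)\ge\min\{v(a),v(b)\}$ and $v(0)=\infty$ (other elements may also have value $\infty$). It is *normalized* if $v(c)\ge 0$ for all $c\in T$ and $v(c)>0$ for all non-units $c$. A $T$-module $M$ is *almost zero* (with respect to $v$) if for all $m\in M$ and $\epsilon>0$ there is $b\in T$ with $bm=0$ and $v(b)<\epsilon$. Let $(R,\mathfrak m)$ be a Noetherian local ring of dimension $d$ and $T$ an $R$-algebra with a value map. A $T$-module $M$ is *almost Cohen–Macaulay over $R$* if the $T$-modules $H^i_{\mathfrak m}(M)$ (the cohomology of the Čech complex of $M$ with respect to a finite sequence generating $\mathfrak m$) are almost zero for all $i\neq d$, but $M/\mathfrak mM$ is not almost zero. For a reduced ring $A$ of prime characteristic $p$, $A_\infty=\bigcup_n A^{p^{-n}}$ denotes its perfect closure. **Corollary.** Let $p$ be a prime, let $R$ be a regular local ring of characteristic $p$, and let $S$ be a reduced local ring that is a module-finite extension of $R$ (so $R\to S$ is injective). Then: 1. $S_\infty$ is an almost Cohen–Macaulay $R$-algebra;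 that is, for every normalized value map $v$ on $S_\infty$ with $v(c)\neq\infty$ for all $0\ne c\in R$, the $S_\infty$-module $S_\infty$ is almost Cohen–Macaulay over $R$ with respect to $v$. 2. The same holds over $R_\infty$: for every normalized value map $v$ on $R_\infty$ with $v(c)\neq\infty$ for all $0\neq c\in R$, the $R_\infty$-module $S_\infty$ is almost Cohen–Macaulay over $R$ with respect to $v$. -/

import Mathlib

/-!  Value maps, almost zero modules, Cech cohomology, almost Cohen-Macaulay modules. -/

namespace AlmostCM

/-- A value map on a ring `T`: a map `v : T → ℝ ∪ {∞}` with `v (a * b) = v a + v b`,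
`v (a + b) ≥ min (v a) (v b)` and `v 0 = ∞`. -/
structure ValueMap (T : Type*) [CommRing T] where
  toFun : T → WithTop ℝ
  map_mul' : ∀ a b : T, toFun (a * b) = toFun a + toFun b
  map_add' : ∀ a b : T, min (toFun a) (toFun b) ≤ toFun (a + b)
  map_zero' : toFun 0 = ⊤

instance (T : Type*) [CommRing T] : CoeFun (ValueMap T) (fun _ => T → WithTop ℝ) where
  coe v := v.toFun

/-- A value map is normalized if it is nonnegative, and positive on the non-units. -/
def ValueMap.IsNormalized {T : Type*} [CommRing T] (v : ValueMap T) : Prop :=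
  (∀ c : T, 0 ≤ v c) ∧ ∀ c : T, ¬ IsUnit c → 0 < v c

/-- A `T`-module `M` is almost zero with respect to `v` if each of its elements is annihilated by
elements of `T` of arbitrarily small value. -/
def AlmostZero {T : Type*} [CommRing T] (v : ValueMap T)
    (M : Type*) [AddCommGroup M] [Module T M] : Prop :=
  ∀ (m : M) (ε : ℝ), 0 < ε → ∃ b : T, b • m = 0 ∧ v b < (ε : WithTop ℝ)

section Cech

variable {T : Type*} [CommRing T] {n : ℕ} (x : Fin n → T) (M : Type*) [AddCommGroup M] [Module T M]

/-- The localization of `M` at the powers of the product of the `x j`, `j ∈ s`. -/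
abbrev CechLoc (s : Finset (Fin n)) : Type _ :=
  LocalizedModule (Submonoid.powers (∏ j ∈ s, x j)) M

variable {M} in
theorem isUnit_end_cechLoc {s t : Finset (Fin n)} (h : s ⊆ t)
    (a : Submonoid.powers (∏ j ∈ s, x j)) :
    IsUnit ((algebraMap T (Module.End T (CechLoc x M t))) a) := by
  obtain ⟨_, k, rfl⟩ := a
  simp only [map_pow]
  refine IsUnit.pow k ?_
  have hu : IsUnit ((algebraMap T (Module.End T (CechLoc x M t))) (∏ j ∈ t, x j)) :=
    IsLocalizedModule.map_units (S := Submonoid.powers (∏ j ∈ t, x j))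
      (LocalizedModule.mkLinearMap (Submonoid.powers (∏ j ∈ t, x j)) M)
      ⟨∏ j ∈ t, x j, Submonoid.mem_powers _⟩
  have he : (∏ j ∈ t, x j) = (∏ j ∈ t \ s, x j) * ∏ j ∈ s, x j := (Finset.prod_sdiff h).symm
  replace hu := (congrArg
    (fun z => IsUnit ((algebraMap T (Module.End T (CechLoc x M t))) z)) he).mp hu
  rw [map_mul] at hu
  exact ((Commute.isUnit_mul_iff (Algebra.commute_algebraMap_left _ _)).mp hu).2

/-- The canonical map between the localizations of `M` attached to `s ⊆ t`. -/
noncomputable def cechRes {s t : Finset (Fin n)} (h : s ⊆ t) :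
    CechLoc x M s →ₗ[T] CechLoc x M t :=
  LocalizedModule.lift (Submonoid.powers (∏ j ∈ s, x j))
    (LocalizedModule.mkLinearMap (Submonoid.powers (∏ j ∈ t, x j)) M)
    (isUnit_end_cechLoc x h)

/-- The Cech cochains of degree `i`: the product (equivalently, the direct sum) of the
localizations of `M` at `x j₁ * ⋯ * x jᵢ`, where `j₁ < ⋯ < jᵢ`. -/
abbrev CechCochain (i : ℕ) : Type _ :=
  ∀ s : {s : Finset (Fin n) // s.card = i}, CechLoc x M s.1

/-- The Cech differential: the component at `s` is the alternating sum, over `j ∈ s`, of the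
images of the components at `s \ {j}`; the sign of the term of `j` is given by the position
of `j` in `s`. -/
noncomputable def cechD (i : ℕ) : CechCochain x M i →ₗ[T] CechCochain x M (i + 1) :=
  LinearMap.pi fun s => ∑ j : {j : Fin n // j ∈ s.1},
    ((-1 : ℤ) ^ (s.1.filter (· < j.1)).card) •
      (cechRes x M (Finset.erase_subset j.1 s.1)).comp
        (LinearMap.proj (⟨s.1.erase j.1, by
          rw [Finset.card_erase_of_mem j.2, s.2, Nat.add_sub_cancel]⟩ :
            {s : Finset (Fin n) // s.card = i}))

/-- The Cech coboundaries of degree `i`. -/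
noncomputable def cechB : (i : ℕ) → Submodule T (CechCochain x M i)
  | 0 => ⊥
  | i + 1 => LinearMap.range (cechD x M i)

/-- The `i`-th cohomology module of the Cech complex of the `T`-module `M` with respect to the
sequence `x`, as a `T`-module: cocycles modulo coboundaries. -/
abbrev CechCohomology (i : ℕ) : Type _ :=
  LinearMap.ker (cechD x M i) ⧸ (cechB x M i).submoduleOf (LinearMap.ker (cechD x M i))

end Cech

/-- Let `(R, 𝔪)` be a Noetherian local ring of dimension `d` and `T` an `R`-algebra with a value
map `v`. The `T`-module `M` is almost Cohen-Macaulay over `R` if the local cohomology modules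
`H^i_𝔪(M)` are almost zero for `i ≠ d`, but `M / 𝔪 M` is not. Here `H^i_𝔪(M)` is the cohomology
of the Cech complex of `M` with respect to a finite sequence that generates `𝔪`; up to
isomorphism it does not depend on that sequence, so all of them are allowed. -/
def IsAlmostCohenMacaulay (R : Type*) [CommRing R] [IsLocalRing R] [IsNoetherianRing R]
    {T : Type*} [CommRing T] [Algebra R T] (v : ValueMap T)
    (M : Type*) [AddCommGroup M] [Module T M] : Prop :=
  (∀ (n : ℕ) (x : Fin n → R), Ideal.span (Set.range x) = IsLocalRing.maximalIdeal R →
    ∀ i : ℕ, (i : WithBot ℕ∞) ≠ ringKrullDim R →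
      AlmostZero v (CechCohomology (fun j => algebraMap R T (x j)) M i)) ∧
  ¬ AlmostZero v
    (M ⧸ ((IsLocalRing.maximalIdeal R).map (algebraMap R T) • (⊤ : Submodule T M)))

section Perfection

variable (p : ℕ) [Fact p.Prime]

/-- The perfect closure of an `R`-algebra `S` of characteristic `p`, as an `R`-algebra through
`R → S → S_∞`. If `S` is reduced, `PerfectClosure S p` is the increasing union of the rings
`S^{p^{-n}}`. -/
noncomputable instance perfectClosureAlgebra (R S : Type*) [CommRing R] [CommRing S] [CharP S p]
    [Algebra R S] : Algebra R (PerfectClosure S p) :=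
  ((PerfectClosure.of S p).comp (algebraMap R S)).toAlgebra

/-- The ring homomorphism `R_∞ → S_∞` induced by `R → S`. -/
noncomputable def perfectClosureMap (R S : Type*) [CommRing R] [CommRing S] [CharP R p] [CharP S p]
    [Algebra R S] : PerfectClosure R p →+* PerfectClosure S p :=
  PerfectClosure.lift R p (PerfectClosure S p) ((PerfectClosure.of S p).comp (algebraMap R S))

/-- `S_∞` as an `R_∞`-module, through the ring homomorphism `R_∞ → S_∞`. -/
noncomputable abbrev perfectClosureModule (R S : Type*) [CommRing R] [CommRing S] [CharP R p]
    [CharP S p] [Algebra R S] : Module (PerfectClosure R p) (PerfectClosure S p) :=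
  Module.compHom (PerfectClosure S p) (perfectClosureMap p R S)

end Perfection

end AlmostCM

/-! Over the regular ring `R` the maximal ideal is generated by a regular sequence of length `dim
R`, so a free module has no local cohomology outside degree `dim R`. A finite module `S` over the
domain `R` factors multiplication by some `c ≠ 0` through a free module, hence `c` kills `H^i_𝔪(S)`
for `i ≠ dim R`. Čech classes are handled as Koszul cocycles of powers of the sequence, up to
transition maps.

Frobenius spreads this to `S_∞`: the `p^N`-th power of a cocycle over `S_∞` has entries in `S` for
large `N`, where `c` makes it a coboundary. Taking `p^N`-th roots, `c^(1/p^N)` kills the original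
class, and its value `v(c)/p^N` tends to `0`. Both parts follow at once by letting a perfect ring
`T` (`S_∞` or `R_∞`) act through a ring homomorphism `ψ`.

For `S_∞ / 𝔪 S_∞` the class of `1` is the obstruction. Over `S_∞`, elements of `𝔪 S_∞` have value at
least that of the generators. Over `R_∞`, a relation `b = ∑ γ_j x_j` is raised to the power `q =
p^N` and pushed down to `R` by a linear `h : S → R` with `h 1 ≠ 0`; the error `v(h 1)/q` is
negligible. -/

namespace AlmostCM

open scoped Pointwise

/-! ### Signs of the Koszul and Čech differentials -/

section Sign

variable {ι : Type*} [LinearOrder ι]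

/-- The sign attached to the position of `j` in `t`. -/
def posSign (j : ι) (t : Finset ι) : ℤ := (-1) ^ (t.filter (· < j)).card

theorem posSign_mul_self (j : ι) (t : Finset ι) : posSign j t * posSign j t = 1 := by
  rw [posSign, ← mul_pow]; simp

theorem posSign_erase_of_not_lt {j l : ι} (t : Finset ι) (h : ¬ l < j) :
    posSign j (t.erase l) = posSign j t := by
  unfold posSign
  congr 2
  ext a
  simp only [Finset.mem_filter, Finset.mem_erase]
  exact ⟨fun ha => ⟨ha.1.2, ha.2⟩, fun ha => ⟨⟨fun e => h (e ▸ ha.2), ha.1⟩, ha.2⟩⟩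

theorem posSign_erase_of_lt {j l : ι} {t : Finset ι} (h : l < j) (hl : l ∈ t) :
    posSign j (t.erase l) = -posSign j t := by
  unfold posSign
  have hm : l ∈ t.filter (· < j) := by simp [h, hl]
  rw [← Finset.card_erase_add_one hm, Finset.filter_erase, pow_succ]
  ring

/-- Removing the smaller index shifts the position of the larger one, but not conversely. This is
the cancellation behind `d² = 0`; the next variant serves the contracting homotopy. -/
theorem posSign_mul_posSign_erase {j l : ι} {t : Finset ι} (hj : j ∈ t) (hl : l ∈ t)
    (hne : j ≠ l) :
    posSign l t * posSign j (t.erase l) = -(posSign j t * posSign l (t.erase j)) := by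
  rcases lt_or_gt_of_ne hne with h | h
  · rw [posSign_erase_of_not_lt t h.not_gt, posSign_erase_of_lt h hj]; ring
  · rw [posSign_erase_of_not_lt t h.not_gt, posSign_erase_of_lt h hl]; ring

theorem posSign_erase_mul_posSign_erase {j l : ι} {t : Finset ι} (hj : j ∈ t) (hl : l ∈ t)
    (hne : j ≠ l) :
    posSign l (t.erase j) * posSign j (t.erase l) = -(posSign j t * posSign l t) := by
  rcases lt_or_gt_of_ne hne with h | h
  · rw [posSign_erase_of_not_lt t h.not_gt, posSign_erase_of_lt h hj]; ring
  · rw [posSign_erase_of_not_lt t h.not_gt, posSign_erase_of_lt h hl]; ring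

end Sign

/-! ### Koszul complexes of powers and their direct limit -/

section Koszul

variable {T : Type*} [CommRing T] {n : ℕ} {M : Type*} [AddCommGroup M] [Module T M]

/-- The Koszul differential of the sequence `x` on families indexed by all subsets. -/
def koszulD (x : Fin n → T) : (Finset (Fin n) → M) →ₗ[T] (Finset (Fin n) → M) :=
  LinearMap.pi fun t => ∑ j ∈ t, posSign j t • x j • LinearMap.proj (t.erase j)

theorem koszulD_apply (x : Fin n → T) (m : Finset (Fin n) → M) (t : Finset (Fin n)) :
    koszulD x m t = ∑ j ∈ t, posSign j t • x j • m (t.erase j) := by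
  simp [koszulD]

theorem koszulD_congr (x : Fin n → T) {m m' : Finset (Fin n) → M} {i : ℕ}
    (h : ∀ s : Finset (Fin n), s.card = i → m s = m' s) {t : Finset (Fin n)}
    (ht : t.card = i + 1) : koszulD x m t = koszulD x m' t := by
  simp only [koszulD_apply]
  refine Finset.sum_congr rfl fun j hj => ?_
  rw [h _ (by rw [Finset.card_erase_of_mem hj, ht, Nat.add_sub_cancel])]

theorem map_koszulD {U N : Type*} [CommRing U] [AddCommGroup N] [Module U N]
    {x : Fin n → T} {y : Fin n → U} (h : M →+ N) (hxy : ∀ j m, h (x j • m) = y j • h m)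
    (m : Finset (Fin n) → M) (t : Finset (Fin n)) :
    h (koszulD x m t) = koszulD y (fun s => h (m s)) t := by
  simp only [koszulD_apply, map_sum, map_zsmul, hxy]

theorem koszulD_koszulD (x : Fin n → T) (m : Finset (Fin n) → M) :
    koszulD x (koszulD x m) = 0 := by
  ext t
  simp only [koszulD_apply, Finset.smul_sum, Pi.zero_apply, Finset.sum_sigma']
  -- The terms cancel in pairs under exchanging the two removed indices.
  refine Finset.sum_involution (fun a _ => ⟨a.2, a.1⟩) ?_ ?_ ?_ ?_
  · rintro ⟨j, l⟩ h
    simp only [Finset.mem_sigma, Finset.mem_erase] at h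
    obtain ⟨hj, hlj, hl⟩ := h
    simp only
    rw [Finset.erase_right_comm (a := l) (b := j)]
    rw [smul_comm (x j) (posSign l _), smul_comm (x l) (posSign j _), smul_smul, smul_smul,
      smul_smul, smul_smul, posSign_mul_posSign_erase hj hl hlj.symm, mul_comm (x l), neg_smul,
      add_neg_cancel]
  · rintro ⟨j, l⟩ h _ e
    simp only [Finset.mem_sigma, Finset.mem_erase] at h
    exact h.2.1 (congrArg Sigma.fst e)
  · rintro ⟨j, l⟩ h
    simp only [Finset.mem_sigma, Finset.mem_erase] at h ⊢
    exact ⟨h.2.2, h.2.1.symm, h.1⟩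
  · rintro ⟨j, l⟩ h
    rfl

/-- Each member of the sequence annihilates Koszul cohomology. -/
theorem exists_koszulD_eq_smul (x : Fin n → T) (m : Finset (Fin n) → M) (i : ℕ)
    (hm : ∀ t : Finset (Fin n), t.card = i + 1 → koszulD x m t = 0) (j : Fin n) :
    ∃ w : Finset (Fin n) → M, ∀ s : Finset (Fin n), s.card = i → x j • m s = koszulD x w s := by
  -- The witness is the contraction of `m` along `j`, a homotopy from multiplication by `x j` to
  -- zero.
  refine ⟨fun s => if j ∈ s then 0 else posSign j (insert j s) • m (insert j s), fun t ht => ?_⟩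
  rw [koszulD_apply]
  by_cases hj : j ∈ t
  · rw [Finset.sum_eq_single_of_mem j hj]
    · simp only [Finset.notMem_erase, if_false, Finset.insert_erase hj]
      rw [smul_comm (x j), smul_smul, posSign_mul_self, one_smul]
    · intro l _ hlj
      rw [if_pos (Finset.mem_erase.2 ⟨hlj.symm, hj⟩), smul_zero, smul_zero]
  -- Here `x j • m t` is one term of the cocycle condition at `insert j t`; the other terms express
  -- it.
  · have h := hm (insert j t) (by rw [Finset.card_insert_of_notMem hj, ht])
    rw [koszulD_apply, Finset.sum_insert hj, Finset.erase_insert hj] at h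
    replace h := congrArg (posSign j (insert j t) • ·) h
    simp only [smul_add, smul_smul, posSign_mul_self, one_smul, smul_zero, Finset.smul_sum] at h
    rw [eq_neg_of_add_eq_zero_left h, ← Finset.sum_neg_distrib]
    refine Finset.sum_congr rfl fun l hl => ?_
    have hlj : l ≠ j := fun e => hj (e ▸ hl)
    have hjl : j ∉ t.erase l := fun h => hj (Finset.mem_of_mem_erase h)
    rw [if_neg hjl, ← Finset.erase_insert_of_ne hlj.symm, smul_comm (x l), smul_smul]
    have key := posSign_erase_mul_posSign_erase (Finset.mem_insert_self j t)
      (Finset.mem_insert_of_mem hl) hlj.symm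
    rw [Finset.erase_insert hj] at key
    rw [key, neg_smul]

/-- Every element of the radical of `(x)` is nilpotent on Koszul cohomology. -/
theorem exists_pow_smul_eq_koszulD {x : Fin n → T} {a : ℕ} {m : Finset (Fin n) → M} {i : ℕ}
    (hm : ∀ t : Finset (Fin n), t.card = i + 1 → koszulD (x ^ a) m t = 0) {y : T}
    (hy : y ∈ (Ideal.span (Set.range x)).radical) :
    ∃ (k : ℕ) (w : Finset (Fin n) → M),
      ∀ s : Finset (Fin n), s.card = i → y ^ k • m s = koszulD (x ^ a) w s := by
  -- The multipliers turning `m` into a coboundary form an ideal, which contains each `x j ^ a`; its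
  -- radical therefore contains that of `(x)`.
  let J : Ideal T :=
    { carrier := {r | ∃ w : Finset (Fin n) → M,
        ∀ s : Finset (Fin n), s.card = i → r • m s = koszulD (x ^ a) w s}
      zero_mem' := ⟨0, fun s _ => by simp⟩
      add_mem' := by
        rintro r r' ⟨w, hw⟩ ⟨w', hw'⟩
        exact ⟨w + w', fun s hs => by rw [add_smul, hw s hs, hw' s hs, map_add, Pi.add_apply]⟩
      smul_mem' := by
        rintro c r ⟨w, hw⟩
        exact ⟨c • w, fun s hs => by
          rw [smul_eq_mul, mul_smul, hw s hs, map_smul, Pi.smul_apply]⟩ }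
  have hJ : Ideal.span (Set.range x) ≤ J.radical := by
    rw [Ideal.span_le]
    rintro _ ⟨j, rfl⟩
    exact ⟨a, exists_koszulD_eq_smul (x ^ a) m i hm j⟩
  obtain ⟨k, hk⟩ := (Ideal.radical_le_radical_iff.2 hJ) hy
  exact ⟨k, hk⟩

/-- These are the transition maps of the direct system whose limit is the Čech complex. -/
theorem koszulD_pow_add (x : Fin n → T) (a e : ℕ) (m : Finset (Fin n) → M)
    (t : Finset (Fin n)) :
    koszulD (x ^ (a + e)) (fun s => (∏ j ∈ s, x j) ^ e • m s) t =
      (∏ j ∈ t, x j) ^ e • koszulD (x ^ a) m t := by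
  simp only [koszulD_apply, Finset.smul_sum]
  refine Finset.sum_congr rfl fun j hj => ?_
  rw [smul_comm _ (posSign j t), smul_smul, smul_smul, ← Finset.mul_prod_erase t x hj]
  congr 2
  simp only [Pi.pow_apply]
  ring

/-- The degree `i` cohomology of the direct limit of the Koszul complexes of the powers of `x`
vanishes. -/
def KoszulLimitVanishes (x : Fin n → T) (M : Type*) [AddCommGroup M] [Module T M] (i : ℕ) : Prop :=
  ∀ (a : ℕ) (m : Finset (Fin n) → M),
    (∀ t : Finset (Fin n), t.card = i + 1 → koszulD (x ^ a) m t = 0) →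
    ∃ (e : ℕ) (w : Finset (Fin n) → M), ∀ s : Finset (Fin n), s.card = i →
      (∏ j ∈ s, x j) ^ e • m s = koszulD (x ^ (a + e)) w s

/-- The long exact sequence of `0 → M → M → M/yM → 0`, by elements: when the limit cohomology of
`M/yM` vanishes one degree lower, multiplication by `y` is injective on that of `M`. -/
theorem exists_koszulD_eq_of_smul {x : Fin n → T} {y : T} (hy : IsSMulRegular M y) {i : ℕ}
    (hv : ∀ k, i = k + 1 → KoszulLimitVanishes x (QuotSMulTop y M) k)
    {a e : ℕ} {m w : Finset (Fin n) → M}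
    (h : ∀ s : Finset (Fin n), s.card = i →
      y • (∏ j ∈ s, x j) ^ e • m s = koszulD (x ^ (a + e)) w s) :
    ∃ (e : ℕ) (w : Finset (Fin n) → M), ∀ s : Finset (Fin n), s.card = i →
      (∏ j ∈ s, x j) ^ e • m s = koszulD (x ^ (a + e)) w s := by
  cases i with
  | zero =>
    refine ⟨e, 0, fun s hs => hy ?_⟩
    simp only
    rw [h s hs, Finset.card_eq_zero.1 hs]
    simp [koszulD_apply]
  | succ k =>
    let π : M →ₗ[T] QuotSMulTop y M := Submodule.mkQ _
    have hπ : ∀ m : M, π (y • m) = 0 := fun m => by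
      rw [Submodule.mkQ_apply, Submodule.Quotient.mk_eq_zero]
      exact Submodule.smul_mem_pointwise_smul _ _ _ trivial
    -- Modulo `y` the cochain `w` is a cocycle, because its differential is a multiple of `y`.
    obtain ⟨f, u, hu⟩ := hv k rfl (a + e) (fun s => π (w s)) (fun t ht => by
      have := map_koszulD (x := x ^ (a + e)) (y := x ^ (a + e)) π.toAddMonoidHom
        (fun j m => π.map_smul _ m) w t
      simp only [LinearMap.toAddMonoidHom_coe] at this
      rw [← this, ← h t ht, hπ])
    have hsurj : Function.Surjective π := Submodule.mkQ_surjective _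
    choose u' hu' using fun s => hsurj (u s)
    have hex : ∀ s : Finset (Fin n), ∃ t : M, s.card = k →
        (∏ j ∈ s, x j) ^ f • w s - koszulD (x ^ (a + e + f)) u' s = y • t := by
      intro s
      by_cases hs : s.card = k
      · have h0 : π ((∏ j ∈ s, x j) ^ f • w s - koszulD (x ^ (a + e + f)) u' s) = 0 := by
          have := map_koszulD (x := x ^ (a + e + f)) (y := x ^ (a + e + f)) π.toAddMonoidHom
            (fun j m => π.map_smul _ m) u' s
          simp only [LinearMap.toAddMonoidHom_coe, hu'] at this
          rw [map_sub, map_smul, hu s hs, this, sub_self]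
        rw [Submodule.mkQ_apply, Submodule.Quotient.mk_eq_zero,
          Submodule.mem_smul_pointwise_iff_exists] at h0
        obtain ⟨t, -, ht⟩ := h0
        exact ⟨t, fun _ => ht.symm⟩
      · exact ⟨0, fun h => absurd h hs⟩
    choose t ht using hex
    -- Up to a transition map, `w` is `y • t` plus a coboundary; applying the differential and
    -- cancelling `y` gives the claim.
    refine ⟨e + f, t, fun s hs => hy ?_⟩
    simp only
    have h1 : koszulD (x ^ (a + (e + f))) (fun s => y • t s) s =
        y • koszulD (x ^ (a + (e + f))) t s :=
      congrFun (map_smul (koszulD (x ^ (a + (e + f)))) y t) s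
    rw [← h1, ← koszulD_congr _ (m := (fun s => (∏ j ∈ s, x j) ^ f • w s) -
      koszulD (x ^ (a + e + f)) u') (fun s hs => ht s hs) hs, map_sub, ← add_assoc,
      koszulD_koszulD, sub_zero, koszulD_pow_add, ← h s hs, smul_smul, smul_smul, smul_smul]
    congr 1
    ring

/-- The limit Koszul cohomology vanishes outside the degree `k` if the radical of `(x)` contains
a weakly regular sequence of length `k` modulo which `x` acts as zero. -/
theorem koszulLimitVanishes_of_isWeaklyRegular {x : Fin n → T} (rs : List T)
    (hrad : ∀ r ∈ rs, r ∈ (Ideal.span (Set.range x)).radical)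
    (hreg : RingTheory.Sequence.IsWeaklyRegular M rs)
    (hx : ∀ j (m : M), x j • m ∈ (Ideal.ofList rs • ⊤ : Submodule T M)) {i : ℕ}
    (hi : i ≠ rs.length) : KoszulLimitVanishes x M i := by
  induction rs generalizing M i with
  | nil =>
    intro a m _
    -- With no regular sequence left, each `x j` kills `M`; as `i ≠ 0` the set `s` is nonempty, so
    -- exponent `1` suffices.
    refine ⟨1, 0, fun s hs => ?_⟩
    obtain ⟨j, hj⟩ : s.Nonempty := by
      rw [← Finset.card_pos, hs]; exact Nat.pos_of_ne_zero hi
    have h0 : x j • m s = 0 := by simpa using hx j (m s)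
    rw [pow_one, ← Finset.prod_erase_mul s x hj, mul_smul, h0]
    simp
  | cons y rs ih =>
    rw [RingTheory.Sequence.isWeaklyRegular_cons_iff] at hreg
    intro a m hm
    have hv : ∀ k, i = k + 1 → KoszulLimitVanishes x (QuotSMulTop y M) k := by
      rintro k rfl
      refine ih (fun r hr => hrad r (List.mem_cons_of_mem _ hr)) hreg.2 (fun j m => ?_)
        (fun h => hi (by simp [h]))
      obtain ⟨m, rfl⟩ := Submodule.mkQ_surjective _ m
      rw [← map_smul]
      have := Submodule.mem_map_of_mem (f := (y • (⊤ : Submodule T M)).mkQ) (hx j m)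
      rw [Ideal.ofList_cons_smul, Submodule.map_sup, Submodule.mkQ_map_self, bot_sup_eq,
        Submodule.map_smul'', Submodule.map_top, Submodule.range_mkQ] at this
      exact this
    -- Some power of `y` kills the class of `m`, and its factors are then cancelled one at a time.
    obtain ⟨k, w, hk⟩ := exists_pow_smul_eq_koszulD hm (hrad y List.mem_cons_self)
    have hstep : ∀ k : ℕ, (∃ (e : ℕ) (w : Finset (Fin n) → M), ∀ s : Finset (Fin n), s.card = i →
        (∏ j ∈ s, x j) ^ e • y ^ k • m s = koszulD (x ^ (a + e)) w s) →
        ∃ (e : ℕ) (w : Finset (Fin n) → M), ∀ s : Finset (Fin n), s.card = i →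
          (∏ j ∈ s, x j) ^ e • m s = koszulD (x ^ (a + e)) w s := by
      intro k
      induction k with
      | zero => simp
      | succ k ihk =>
        rintro ⟨e, w, hw⟩
        refine ihk (exists_koszulD_eq_of_smul hreg.1 hv (e := e) (w := w) fun s hs => ?_)
        rw [← hw s hs, pow_succ', mul_smul, smul_comm]
    exact hstep k ⟨0, w, fun s hs => by simpa using hk s hs⟩

end Koszul

/-! ### Regular local rings: domains with a regular sequence generating `𝔪` -/

section RegularLocal

open IsLocalRing RingTheory.Sequence

/-- In a Noetherian local ring of positive dimension, some element of `𝔪 \ 𝔪²` avoids all minimal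
primes. -/
theorem exists_mem_maximalIdeal_notMem_sq_notMem_minimalPrimes (R : Type*) [CommRing R]
    [IsLocalRing R] [IsNoetherianRing R] (h : 0 < ringKrullDim R) :
    ∃ x ∈ maximalIdeal R, x ∉ maximalIdeal R ^ 2 ∧ ∀ P ∈ minimalPrimes R, x ∉ P := by
  have hht : 0 < (maximalIdeal R).height := by
    rw [← maximalIdeal_height_eq_ringKrullDim] at h
    exact_mod_cast h
  by_contra! hc
  have hsub : (maximalIdeal R : Set R) ⊆
      ⋃ P ∈ insert (maximalIdeal R ^ 2) (minimalPrimes R), (P : Set R) := by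
    intro x hx
    simp only [Set.mem_iUnion]
    by_cases hx2 : x ∈ maximalIdeal R ^ 2
    · exact ⟨_, Set.mem_insert _ _, hx2⟩
    · obtain ⟨P, hP, hxP⟩ := hc x hx hx2
      exact ⟨P, Set.mem_insert_of_mem _ hP, hxP⟩
  obtain ⟨P, hP, hle⟩ := (Ideal.subset_union_prime_finite (f := id)
    ((minimalPrimes.finite_of_isNoetherianRing R).insert _) (maximalIdeal R ^ 2)
    (maximalIdeal R ^ 2) (fun P hP hne _ => by
      rcases hP with rfl | hP
      · exact absurd rfl hne
      · exact hP.1.1)).1 hsub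
  rcases hP with rfl | hP
  · have h0 : maximalIdeal R = ⊥ := by
      refine Submodule.eq_bot_of_le_smul_of_le_jacobson_bot (maximalIdeal R) (maximalIdeal R)
        (IsNoetherian.noetherian _) ?_ (maximalIdeal_le_jacobson _)
      simpa [sq] using hle
    rw [h0] at hht
    have := (Ideal.height_bot (R := R))
    exact hht.ne' this
  · have hPp : P.IsPrime := hP.1.1
    have h0 : P.height = 0 := Ideal.height_eq_zero_iff.2 hP
    have : (maximalIdeal R).height ≤ P.height := Ideal.height_mono hle
    rw [h0] at this
    exact absurd hht (not_lt.2 this)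

/-- An element of `𝔪 \ 𝔪²` can be exchanged for some member of a generating family of `𝔪`. -/
theorem exists_span_singleton_sup_span_eq_maximalIdeal {R : Type*} [CommRing R] [IsLocalRing R]
    {n : ℕ} {g : Fin (n + 1) → R} (hg : Ideal.span (Set.range g) = maximalIdeal R) {x : R}
    (hx : x ∈ maximalIdeal R) (hx2 : x ∉ maximalIdeal R ^ 2) :
    ∃ g' : Fin n → R, Ideal.span {x} ⊔ Ideal.span (Set.range g') = maximalIdeal R := by
  have hgm : ∀ i, g i ∈ maximalIdeal R := fun i => hg ▸ Ideal.subset_span ⟨i, rfl⟩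
  obtain ⟨c, hc⟩ := (Ideal.mem_span_range_iff_exists_fun).1 (hg ▸ hx)
  have : ∃ i, IsUnit (c i) := by
    by_contra! h
    refine hx2 (hc ▸ Ideal.sum_mem _ fun i _ => ?_)
    rw [sq]
    exact Ideal.mul_mem_mul ((mem_maximalIdeal _).2 (h i)) (hgm i)
  obtain ⟨i, hi⟩ := this
  refine ⟨fun j => g (i.succAbove j), le_antisymm (sup_le ?_ ?_) ?_⟩
  · rwa [Ideal.span_singleton_le_iff_mem]
  · rw [Ideal.span_le]
    rintro _ ⟨j, rfl⟩
    exact hgm _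
  · rw [← hg, Ideal.span_le]
    have hmem : ∀ j, g (i.succAbove j) ∈
        Ideal.span {x} ⊔ Ideal.span (Set.range fun j => g (i.succAbove j)) :=
      fun j => Ideal.mem_sup_right (Ideal.subset_span ⟨j, rfl⟩)
    rintro _ ⟨k, rfl⟩
    rcases Fin.eq_self_or_eq_succAbove i k with rfl | ⟨j, rfl⟩
    · rw [Fin.sum_univ_succAbove _ k] at hc
      have : c k * g k ∈ Ideal.span {x} ⊔ Ideal.span (Set.range fun j => g (k.succAbove j)) := by
        rw [eq_sub_of_add_eq hc]
        refine Ideal.sub_mem _ (Ideal.mem_sup_left (Ideal.mem_span_singleton_self x)) ?_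
        exact Ideal.sum_mem _ fun j _ => Ideal.mul_mem_left _ _ (hmem j)
      exact (Ideal.unit_mul_mem_iff_mem _ hi).1 this
    · exact hmem j

/-- If a principal ideal `(x) ⊆ 𝔪` of a Noetherian local ring is prime and `x` lies in no minimal
prime, then the ring is a domain. -/
theorem isDomain_of_isPrime_span_singleton {R : Type*} [CommRing R] [IsLocalRing R]
    [IsNoetherianRing R] {x : R} (hx : x ∈ maximalIdeal R) (hmin : ∀ P ∈ minimalPrimes R, x ∉ P)
    (hprime : (Ideal.span {x}).IsPrime) : IsDomain R := by
  obtain ⟨P, hP, hle⟩ := Ideal.exists_minimalPrimes_le (I := (⊥ : Ideal R)) (J := Ideal.span {x})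
    bot_le
  have hPp : P.IsPrime := hP.1.1
  have hxP : x ∉ P := hmin P hP
  -- An element of `P ⊆ (x)` is `b * x` with `b ∈ P`, as `x ∉ P`; so `P ⊆ 𝔪P` and Nakayama applies.
  have h0 : P = ⊥ := by
    refine Submodule.eq_bot_of_le_smul_of_le_jacobson_bot (maximalIdeal R) P
      (IsNoetherian.noetherian _) (fun a ha => ?_) (maximalIdeal_le_jacobson _)
    obtain ⟨b, rfl⟩ := Ideal.mem_span_singleton'.1 (hle ha)
    rw [mul_comm, smul_eq_mul]
    exact Ideal.mul_mem_mul hx ((hPp.mem_or_mem ha).resolve_right hxP)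
  rw [h0] at hPp
  exact IsDomain.of_bot_isPrime R

/-- A Noetherian local ring of dimension at least `n` whose maximal ideal is generated by `n`
elements is a domain, and its maximal ideal is generated by a regular sequence of length `n`. -/
theorem exists_isWeaklyRegular_of_span_eq_maximalIdeal (n : ℕ) (R : Type*) [CommRing R]
    [IsLocalRing R] [IsNoetherianRing R] (g : Fin n → R)
    (hg : Ideal.span (Set.range g) = maximalIdeal R) (hn : n ≤ ringKrullDim R) :
    IsDomain R ∧ ∃ rs : List R, rs.length = n ∧ Ideal.ofList rs = maximalIdeal R ∧
      IsWeaklyRegular R rs := by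
  induction n generalizing R with
  | zero =>
    have h0 : maximalIdeal R = ⊥ := by rw [← hg]; simp
    refine ⟨?_, [], rfl, by simp [h0], IsWeaklyRegular.nil R R⟩
    exact (isField_iff_maximalIdeal_eq.2 h0).isDomain
  | succ n ih =>
    obtain ⟨x, hx, hx2, hmin⟩ := exists_mem_maximalIdeal_notMem_sq_notMem_minimalPrimes R
      (lt_of_lt_of_le (by exact_mod_cast Nat.succ_pos n) hn)
    obtain ⟨g', hg'⟩ := exists_span_singleton_sup_span_eq_maximalIdeal hg hx hx2
    have hle : Ideal.span {x} ≤ maximalIdeal R := (Ideal.span_singleton_le_iff_mem _).2 hx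
    have : Nontrivial (R ⧸ Ideal.span {x}) :=
      Ideal.Quotient.nontrivial_iff.2 (ne_top_of_le_ne_top Ideal.IsPrime.ne_top' hle)
    have hloc : IsLocalRing (R ⧸ Ideal.span {x}) :=
      IsLocalRing.of_surjective' _ Ideal.Quotient.mk_surjective
    have hmap : (maximalIdeal R).map (Ideal.Quotient.mk (Ideal.span {x})) =
        maximalIdeal (R ⧸ Ideal.span {x}) :=
      map_maximalIdeal_of_surjective _ Ideal.Quotient.mk_surjective
    have hg'' : Ideal.span (Set.range fun i => Ideal.Quotient.mk (Ideal.span {x}) (g' i)) =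
        maximalIdeal (R ⧸ Ideal.span {x}) := by
      rw [← hmap, ← hg', Ideal.map_sup, Ideal.map_quotient_self, bot_sup_eq, Ideal.map_span,
        ← Set.range_comp]
      rfl
    -- Dividing by one element lowers the dimension by at most one.
    have hdim : (n : WithBot ℕ∞) ≤ ringKrullDim (R ⧸ Ideal.span {x}) := by
      have h1 := Ideal.height_le_ringKrullDim_quotient_add_one hx
      rw [maximalIdeal_height_eq_ringKrullDim] at h1
      have h2 := hn.trans h1
      push_cast at h2
      exact ENat.WithBot.add_le_add_one_right_iff.1 h2
    obtain ⟨hdom, rs, hlen, hrs, hreg⟩ := ih (R ⧸ Ideal.span {x}) _ hg'' hdim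
    have hR : IsDomain R := isDomain_of_isPrime_span_singleton hx hmin
      ((Ideal.Quotient.isDomain_iff_prime _).1 hdom)
    obtain ⟨rs, rfl⟩ := List.map_surjective_iff.2 Ideal.Quotient.mk_surjective rs
    have hx0 : x ≠ 0 := by
      rintro rfl
      exact hx2 (zero_mem _)
    refine ⟨hR, x :: rs, by simpa using hlen, ?_, ?_⟩
    · rw [← Ideal.map_ofList, ← hmap] at hrs
      have := congrArg (Ideal.comap (Ideal.Quotient.mk (Ideal.span {x}))) hrs
      rw [Ideal.comap_map_of_surjective' _ Ideal.Quotient.mk_surjective,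
        Ideal.comap_map_of_surjective' _ Ideal.Quotient.mk_surjective, Ideal.mk_ker,
        sup_eq_left.2 hle] at this
      rw [Ideal.ofList_cons, sup_comm, this]
    · refine IsWeaklyRegular.cons (isSMulRegular_iff_right_eq_zero_of_smul.2 fun r hr =>
        (mul_eq_zero.1 hr).resolve_left hx0) ?_
      have h1 := (isWeaklyRegular_map_algebraMap_iff (R := R) (R ⧸ Ideal.span {x})
        (R ⧸ Ideal.span {x}) rs).1 hreg
      refine (LinearEquiv.isWeaklyRegular_congr (Submodule.quotEquivOfEq _ _ ?_) rs).1 h1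
      rw [← Submodule.ideal_span_singleton_smul, smul_eq_mul, Ideal.mul_top]

theorem _root_.IsRegularLocalRing.isDomain_and_exists_isWeaklyRegular (R : Type*) [CommRing R]
    [IsRegularLocalRing R] :
    IsDomain R ∧ ∃ rs : List R, (rs.length : WithBot ℕ∞) = ringKrullDim R ∧
      Ideal.ofList rs = maximalIdeal R ∧ IsWeaklyRegular R rs := by
  have hfg : (maximalIdeal R).FG := IsNoetherian.noetherian _
  have hfin := Submodule.FG.finite_generators hfg
  have hcard := Submodule.FG.generators_ncard hfg
  have hspan := (maximalIdeal R).span_generators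
  rw [← Nat.card_coe_set_eq] at hcard
  have := hfin.to_subtype
  let e := (Finite.equivFinOfCardEq hcard).symm
  obtain ⟨h, rs, h1, h2⟩ := exists_isWeaklyRegular_of_span_eq_maximalIdeal _ R
    (fun i => (e i : R)) (by
      rw [show (fun i => (e i : R)) = Subtype.val ∘ e from rfl, Set.range_comp, e.range_eq_univ,
        Set.image_univ, Subtype.range_coe]
      exact hspan) (IsRegularLocalRing.spanFinrank_maximalIdeal (R := R)).le
  exact ⟨h, rs, by rw [h1, IsRegularLocalRing.spanFinrank_maximalIdeal], h2⟩

/-- A weakly regular sequence on `R` remains so on a flat module, and here its length is `dim R`. -/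
theorem koszulLimitVanishes_finsupp {R : Type*} [CommRing R] [IsRegularLocalRing R] (ι : Type*)
    {n : ℕ} {x : Fin n → R} (hx : ∀ j, x j ∈ maximalIdeal R)
    (hrad : maximalIdeal R ≤ (Ideal.span (Set.range x)).radical) {i : ℕ}
    (hi : (i : WithBot ℕ∞) ≠ ringKrullDim R) : KoszulLimitVanishes x (ι →₀ R) i := by
  obtain ⟨-, rs, hlen, hrs, hreg⟩ :=
    IsRegularLocalRing.isDomain_and_exists_isWeaklyRegular R
  refine koszulLimitVanishes_of_isWeaklyRegular rs (fun r hr => hrad ?_) ?_ (fun j m => ?_) ?_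
  · exact hrs ▸ Ideal.subset_span hr
  · exact ((TensorProduct.lid R (ι →₀ R)).isWeaklyRegular_congr rs).1
      hreg.isWeaklyRegular_rTensor
  · exact Submodule.smul_mem_smul (hrs ▸ hx j) trivial
  · rintro rfl
    exact hi hlen

end RegularLocal

/-! ### Čech cochains as fractions with Koszul numerators -/

section CechFractions

variable {T : Type*} [CommRing T] {n : ℕ} (x : Fin n → T) {M : Type*} [AddCommGroup M] [Module T M]

/-- The map `m ↦ m / (∏ j ∈ s, x j) ^ a`. -/
noncomputable def cechFrac (a : ℕ) (s : Finset (Fin n)) : M →ₗ[T] CechLoc x M s :=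
  (LocalizedModule.divBy ⟨(∏ j ∈ s, x j) ^ a, pow_mem (Submonoid.mem_powers _) a⟩).comp
    (LocalizedModule.mkLinearMap (Submonoid.powers (∏ j ∈ s, x j)) M)

theorem cechFrac_apply (a : ℕ) (s : Finset (Fin n)) (m : M) :
    cechFrac x a s m = LocalizedModule.mk m ⟨(∏ j ∈ s, x j) ^ a, pow_mem (Submonoid.mem_powers _) a⟩ := by
  simp only [cechFrac, LinearMap.comp_apply, LocalizedModule.mkLinearMap_apply,
    LocalizedModule.divBy_apply, LocalizedModule.liftOn_mk, one_mul]

theorem cechFrac_pow_smul (a : ℕ) (s : Finset (Fin n)) (m : M) :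
    cechFrac x a s ((∏ j ∈ s, x j) ^ a • m) =
      LocalizedModule.mkLinearMap (Submonoid.powers (∏ j ∈ s, x j)) M m := by
  rw [cechFrac_apply, LocalizedModule.mkLinearMap_apply]
  exact LocalizedModule.mk_cancel ⟨(∏ j ∈ s, x j) ^ a, pow_mem (Submonoid.mem_powers _) a⟩ m

theorem cechFrac_add_pow_smul (a e : ℕ) (s : Finset (Fin n)) (m : M) :
    cechFrac x (a + e) s ((∏ j ∈ s, x j) ^ e • m) = cechFrac x a s m := by
  rw [cechFrac_apply, cechFrac_apply, LocalizedModule.mk_eq]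
  refine ⟨1, ?_⟩
  simp only [one_smul, Submonoid.smul_def, smul_smul, pow_add]

theorem exists_eq_cechFrac (s : Finset (Fin n)) (z : CechLoc x M s) :
    ∃ (a : ℕ) (m : M), z = cechFrac x a s m := by
  induction z using LocalizedModule.induction_on with
  | h m d =>
    obtain ⟨_, a, rfl⟩ := d
    exact ⟨a, m, (cechFrac_apply x a s m).symm⟩

theorem exists_pow_smul_eq_zero_of_cechFrac_eq_zero {a : ℕ} {s : Finset (Fin n)} {m : M}
    (h : cechFrac x a s m = 0) : ∃ e : ℕ, (∏ j ∈ s, x j) ^ e • m = 0 := by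
  rw [cechFrac_apply, ← LocalizedModule.zero_mk 1, LocalizedModule.mk_eq] at h
  obtain ⟨⟨_, e, rfl⟩, h⟩ := h
  exact ⟨e, by simpa [Submonoid.smul_def] using h⟩

theorem cechRes_cechFrac (a : ℕ) {s t : Finset (Fin n)} (h : s ⊆ t) (m : M) :
    cechRes x M h (cechFrac x a s m) = cechFrac x a t ((∏ j ∈ t \ s, x j) ^ a • m) := by
  have hu := isUnit_end_cechLoc (M := M) x h ⟨(∏ j ∈ s, x j) ^ a, pow_mem (Submonoid.mem_powers _) a⟩
  -- The denominator over `s` acts invertibly on the target, so it may be cleared.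
  apply ((Module.End.isUnit_iff _).1 hu).1
  simp only [Module.algebraMap_end_apply]
  rw [← map_smul, ← map_smul, ← map_smul, cechFrac_pow_smul, smul_smul, ← mul_pow, mul_comm,
    Finset.prod_sdiff h, cechFrac_pow_smul, LocalizedModule.mkLinearMap_apply]
  exact LocalizedModule.lift_mk_one _ _ _ _

/-- The cochain of degree `i` with components `m s / (∏ j ∈ s, x j) ^ a`. -/
noncomputable def cechFracCochain (a i : ℕ) (m : Finset (Fin n) → M) : CechCochain x M i :=
  fun s => cechFrac x a s.1 (m s.1)

theorem cechD_cechFracCochain (a i : ℕ) (m : Finset (Fin n) → M)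
    (t : {t : Finset (Fin n) // t.card = i + 1}) :
    cechD x M i (cechFracCochain x a i m) t =
      cechFrac x a t.1 (koszulD (x ^ a) m t.1) := by
  rw [koszulD_apply, map_sum, ← Finset.sum_coe_sort]
  simp only [cechD, LinearMap.pi_apply, LinearMap.sum_apply]
  refine Finset.sum_congr rfl fun j _ => ?_
  change (-1 : ℤ) ^ _ • cechRes x M (Finset.erase_subset j.1 t.1) (cechFrac x a _ _) = _
  rw [cechRes_cechFrac, map_zsmul, posSign, Finset.sdiff_erase_self j.2, Finset.prod_singleton]
  rfl

theorem exists_eq_cechFracCochain (i : ℕ) (z : CechCochain x M i) :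
    ∃ (a : ℕ) (m : Finset (Fin n) → M), z = cechFracCochain x a i m := by
  have h : ∀ s : {s : Finset (Fin n) // s.card = i}, ∃ (a : ℕ) (m : M),
      z s = cechFrac x a s.1 m := fun s => exists_eq_cechFrac x s.1 (z s)
  choose a m h using h
  refine ⟨∑ s, a s, fun s => if hs : s.card = i then
    (∏ j ∈ s, x j) ^ ((∑ s, a s) - a ⟨s, hs⟩) • m ⟨s, hs⟩ else 0, funext fun s => ?_⟩
  have hle : a s ≤ ∑ s, a s := Finset.single_le_sum (fun _ _ => Nat.zero_le _) (Finset.mem_univ s)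
  rw [h s, cechFracCochain, dif_pos s.2]
  conv_rhs => rw [← Nat.add_sub_cancel' hle, Nat.add_sub_cancel_left, cechFrac_add_pow_smul]

/-- The numerators of a cocycle satisfy the Koszul condition only up to powers of the products;
enlarging the common exponent absorbs these finitely many powers. -/
theorem exists_koszul_cocycle (i : ℕ) (z : CechCochain x M i) (hz : cechD x M i z = 0) :
    ∃ (a : ℕ) (m : Finset (Fin n) → M), z = cechFracCochain x a i m ∧
      ∀ t : Finset (Fin n), t.card = i + 1 → koszulD (x ^ a) m t = 0 := by
  obtain ⟨a, m, rfl⟩ := exists_eq_cechFracCochain x i z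
  have h0 : ∀ t : {t : Finset (Fin n) // t.card = i + 1},
      ∃ e : ℕ, (∏ j ∈ t.1, x j) ^ e • koszulD (x ^ a) m t.1 = 0 := fun t =>
    exists_pow_smul_eq_zero_of_cechFrac_eq_zero x (a := a) <| by
      rw [← cechD_cechFracCochain, hz, Pi.zero_apply]
  choose e he using h0
  refine ⟨a + ∑ t, e t, fun s => (∏ j ∈ s, x j) ^ (∑ t, e t) • m s,
    funext fun s => (cechFrac_add_pow_smul x _ _ _ _).symm, fun t ht => ?_⟩
  have hle : e ⟨t, ht⟩ ≤ ∑ t, e t :=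
    Finset.single_le_sum (fun _ _ => Nat.zero_le _) (Finset.mem_univ (⟨t, ht⟩ : Subtype _))
  rw [koszulD_pow_add, ← Nat.sub_add_cancel hle, pow_add, mul_smul, he ⟨t, ht⟩, smul_zero]

theorem smul_mem_cechB {i : ℕ} {a e : ℕ} {m w : Finset (Fin n) → M} {b : T}
    (h : ∀ s : Finset (Fin n), s.card = i →
      b • (∏ j ∈ s, x j) ^ e • m s = koszulD (x ^ (a + e)) w s) :
    b • cechFracCochain x a i m ∈ cechB x M i := by
  have key : ∀ s : {s : Finset (Fin n) // s.card = i},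
      b • cechFrac x a s.1 (m s.1) = cechFrac x (a + e) s.1 (koszulD (x ^ (a + e)) w s.1) :=
    fun s => by rw [← h s.1 s.2, map_smul, cechFrac_add_pow_smul]
  cases i with
  | zero =>
    refine (Submodule.mem_bot T).2 (funext fun s => ?_)
    rw [Pi.smul_apply, cechFracCochain, key s, koszulD_apply]
    obtain ⟨s, hs⟩ := s
    obtain rfl := Finset.card_eq_zero.1 hs
    rw [Finset.sum_empty, map_zero, Pi.zero_apply]
  | succ k =>
    refine ⟨cechFracCochain x (a + e) k w, funext fun s => ?_⟩
    rw [cechD_cechFracCochain, Pi.smul_apply, cechFracCochain, key s]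

/-- A criterion for the Cech cohomology to be almost zero in terms of numerators. -/
theorem almostZero_cechCohomology (v : ValueMap T) (i : ℕ)
    (h : ∀ (a : ℕ) (m : Finset (Fin n) → M),
      (∀ t : Finset (Fin n), t.card = i + 1 → koszulD (x ^ a) m t = 0) →
      ∀ ε : ℝ, 0 < ε → ∃ b : T, v b < (ε : WithTop ℝ) ∧
        ∃ (e : ℕ) (w : Finset (Fin n) → M), ∀ s : Finset (Fin n), s.card = i →
          b • (∏ j ∈ s, x j) ^ e • m s = koszulD (x ^ (a + e)) w s) :
    AlmostZero v (CechCohomology x M i) := by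
  intro z ε hε
  obtain ⟨⟨z, hz⟩, rfl⟩ := Submodule.Quotient.mk_surjective _ z
  obtain ⟨a, m, rfl, hm⟩ := exists_koszul_cocycle x i z hz
  obtain ⟨b, hb, e, w, hw⟩ := h a m hm ε hε
  refine ⟨b, ?_, hb⟩
  rw [← Submodule.Quotient.mk_smul, Submodule.Quotient.mk_eq_zero]
  exact smul_mem_cechB x hw

end CechFractions

/-! ### Elementary properties of value maps -/

namespace ValueMap

variable {T : Type*} [CommRing T] (v : ValueMap T)

theorem map_pow_succ (a : T) (n : ℕ) : v (a ^ (n + 1)) = (n + 1) • v a := by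
  induction n with
  | zero => simp
  | succ n ih => rw [pow_succ, v.map_mul', ih, ← succ_nsmul]

/-- Exponent `0` is excluded because a value map may be identically `∞`, even at `1`. -/
theorem map_pow (a : T) {n : ℕ} (hn : n ≠ 0) : v (a ^ n) = n • v a := by
  obtain ⟨k, rfl⟩ := Nat.exists_eq_succ_of_ne_zero hn
  exact v.map_pow_succ a k

theorem lt_of_map_pow_lt {a : T} {n : ℕ} (hn : n ≠ 0) {ε : ℝ}
    (h : v (a ^ n) < ((n * ε : ℝ) : WithTop ℝ)) : v a < (ε : WithTop ℝ) := by
  by_contra! hc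
  rw [v.map_pow a hn, ← nsmul_eq_mul, WithTop.coe_nsmul] at h
  exact absurd h (not_lt.2 (nsmul_le_nsmul_right hc n))

theorem le_of_mem_span (hv : ∀ c, 0 ≤ v c) {ι : Type*} {y : ι → T} {μ : WithTop ℝ}
    (hy : ∀ j, μ ≤ v (y j)) {b : T} (hb : b ∈ Ideal.span (Set.range y)) : μ ≤ v b := by
  let J : Ideal T :=
    { carrier := {r | μ ≤ v r}
      zero_mem' := by rw [Set.mem_ofPred_eq, v.map_zero']; exact le_top
      add_mem' := fun ha hb => (le_min ha hb).trans (v.map_add' _ _)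
      smul_mem' := fun c r hr => by
        rw [smul_eq_mul, Set.mem_ofPred_eq, v.map_mul']
        exact hr.trans (le_add_of_nonneg_left (hv c)) }
  have hJ : Ideal.span (Set.range y) ≤ J := Ideal.span_le.2 (by rintro _ ⟨j, rfl⟩; exact hy j)
  exact hJ hb

theorem exists_pos_forall_le {ι : Type*} [Finite ι] (y : ι → T) (hy : ∀ j, 0 < v (y j)) :
    ∃ μ : ℝ, 0 < μ ∧ ∀ j, (μ : WithTop ℝ) ≤ v (y j) := by
  have h : ∀ j, ∃ δ : ℝ, 0 < δ ∧ (δ : WithTop ℝ) ≤ v (y j) := fun j => by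
    by_cases h : v (y j) = ⊤
    · exact ⟨1, one_pos, h ▸ le_top⟩
    · obtain ⟨r, h⟩ := WithTop.ne_top_iff_exists.1 h
      exact ⟨r, by have := hy j; rw [← h] at this; exact_mod_cast this, h.le⟩
  choose δ hδ hle using h
  cases isEmpty_or_nonempty ι
  · exact ⟨1, one_pos, fun j => isEmptyElim j⟩
  · obtain ⟨j₀, h₀⟩ := Finite.exists_min δ
    exact ⟨δ j₀, hδ j₀, fun j => (WithTop.coe_le_coe.2 (h₀ j)).trans (hle j)⟩

end ValueMap

/-- A finite module over a domain embeds, up to a nonzero scalar, in a free submodule of itself. -/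
theorem exists_linearMap_finsupp_comp_eq_smul (R S : Type*) [CommRing R] [IsDomain R]
    [AddCommGroup S] [Module R S] [Module.Finite R S] :
    ∃ (B : Set S) (f : (B →₀ R) →ₗ[R] S) (g : S →ₗ[R] (B →₀ R)) (c : R), c ≠ 0 ∧
      ∀ s, f (g s) = c • s := by
  classical
  -- By maximality every element has a nonzero multiple in the span of `B`; `c` multiplies such
  -- factors over a finite generating set.
  obtain ⟨B, hB, hmax⟩ := exists_maximal_linearIndepOn R (id : S → S)
  have hli : LinearIndependent R (Subtype.val : B → S) := hB
  have hspan : ∀ s : S, ∃ a : R, a ≠ 0 ∧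
      a • s ∈ Submodule.span R (Set.range (Subtype.val : B → S)) := by
    intro s
    rw [Subtype.range_coe]
    by_cases hs : s ∈ B
    · exact ⟨1, one_ne_zero, by rw [one_smul]; exact Submodule.subset_span hs⟩
    · simpa using hmax s hs
  choose a ha0 ha using hspan
  obtain ⟨G, hG⟩ := (Module.Finite.fg_top : (⊤ : Submodule R S).FG)
  let c : R := ∏ s ∈ G, a s
  have hc : ∀ s : S, c • s ∈ Submodule.span R (Set.range (Subtype.val : B → S)) := by
    intro s
    have hle : (⊤ : Submodule R S) ≤
        (Submodule.span R (Set.range (Subtype.val : B → S))).comap (LinearMap.lsmul R S c) := by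
      rw [← hG, Submodule.span_le]
      intro s hs
      change c • s ∈ Submodule.span R (Set.range (Subtype.val : B → S))
      rw [show c = (∏ s ∈ G.erase s, a s) * a s from (Finset.prod_erase_mul G a hs).symm, mul_smul]
      exact Submodule.smul_mem _ _ (ha s)
    exact hle (Submodule.mem_top (x := s))
  refine ⟨B, Finsupp.linearCombination R Subtype.val,
    hli.repr.comp ((LinearMap.lsmul R S c).codRestrict _ hc), c,
    Finset.prod_ne_zero_iff.2 fun s _ => ha0 s, fun s => ?_⟩
  rw [LinearMap.comp_apply, hli.linearCombination_repr]
  rfl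

/-! ### Descent from the perfect closure by `p`-power maps -/

section PerfectClosure

variable (p : ℕ) [Fact p.Prime] {S : Type*} [CommRing S] [CharP S p]

theorem exists_pow_eq_of (m : PerfectClosure S p) :
    ∃ N₀ : ℕ, ∀ N, N₀ ≤ N → ∃ μ : S, m ^ p ^ N = PerfectClosure.of S p μ := by
  obtain ⟨⟨k, y⟩, rfl⟩ := PerfectClosure.mk_surjective S p m
  refine ⟨k, fun N hN => ⟨y ^ p ^ (N - k), ?_⟩⟩
  have h := PerfectClosure.iterate_frobenius_mk S p k y
  rw [iterate_frobenius] at h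
  rw [← Nat.add_sub_cancel' hN, Nat.add_sub_cancel_left, pow_add, pow_mul, h, map_pow]

theorem exists_forall_pow_eq_of {ι : Type*} [Finite ι] (m : ι → PerfectClosure S p) :
    ∃ N₀ : ℕ, ∀ N, N₀ ≤ N → ∃ μ : ι → S, ∀ i, m i ^ p ^ N = PerfectClosure.of S p (μ i) := by
  cases nonempty_fintype ι
  choose N₀ h using fun i => exists_pow_eq_of p (m i)
  refine ⟨∑ i, N₀ i, fun N hN => ?_⟩
  choose μ hμ using fun i =>
    h i N ((Finset.single_le_sum (fun _ _ => Nat.zero_le _) (Finset.mem_univ i)).trans hN)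
  exact ⟨μ, hμ⟩

theorem perfectClosure_of_injective [IsReduced S] : Function.Injective (PerfectClosure.of S p) := by
  intro a b h
  rw [PerfectClosure.of_apply, PerfectClosure.of_apply, PerfectClosure.eq_iff] at h
  exact h

/-- A `p`-power of the inverse comes from `S`, so a power of `a` is invertible there. -/
theorem isUnit_of_isUnit_of [IsReduced S] {a : S} (h : IsUnit (PerfectClosure.of S p a)) :
    IsUnit a := by
  obtain ⟨b, hb⟩ := h.exists_right_inv
  obtain ⟨N, hN⟩ := exists_pow_eq_of p b
  obtain ⟨β, hβ⟩ := hN N le_rfl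
  have h1 : a ^ p ^ N * β = 1 := by
    apply perfectClosure_of_injective p
    rw [map_mul, map_pow, ← hβ, ← mul_pow, hb, one_pow, map_one]
  have := IsUnit.of_mul_eq_one _ h1
  exact (isUnit_pow_iff (pow_ne_zero N (Fact.out : p.Prime).ne_zero)).1 this

theorem exists_pow_pos_lt (r ε : ℝ) (hε : 0 < ε) (N₀ : ℕ) :
    ∃ N, N₀ ≤ N ∧ r < ((p ^ N : ℕ) : ℝ) * ε := by
  obtain ⟨k, hk⟩ := exists_nat_gt (r / ε)
  refine ⟨max N₀ k, le_max_left _ _, (div_lt_iff₀ hε).1 (hk.trans_le ?_)⟩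
  exact_mod_cast (Nat.lt_pow_self (Fact.out : p.Prime).one_lt).le.trans
    (Nat.pow_le_pow_right (Fact.out : p.Prime).pos (le_max_right N₀ k))

end PerfectClosure

/-! ### Almost vanishing below and above `dim R`, and nonvanishing modulo `𝔪` -/

section Main

variable (p : ℕ) [Fact p.Prime] {R S : Type*} [CommRing R] [IsRegularLocalRing R]
  [CommRing S] [IsReduced S] [CharP S p] [Algebra R S] [Module.Finite R S]

open IsLocalRing

/-- Over a ring `T` acting on `S_∞` through a ring homomorphism compatible with `R`, the Cech
cohomology of `S_∞` is almost zero outside the degree `dim R`. -/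
theorem almostZero_cechCohomology_perfectClosure {T : Type*} [CommRing T] [CharP T p]
    [PerfectRing T p] [Algebra R T] [Module T (PerfectClosure S p)]
    (ψ : T →+* PerfectClosure S p) (hψ : ∀ (t : T) (m : PerfectClosure S p), t • m = ψ t * m)
    (hR : ∀ r : R, ψ (algebraMap R T r) = PerfectClosure.of S p (algebraMap R S r))
    (v : ValueMap T) (hv : ∀ c : R, c ≠ 0 → v (algebraMap R T c) ≠ ⊤)
    {n : ℕ} {x : Fin n → R} (hx : Ideal.span (Set.range x) = maximalIdeal R) {i : ℕ}
    (hi : (i : WithBot ℕ∞) ≠ ringKrullDim R) :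
    AlmostZero v (CechCohomology (fun j => algebraMap R T (x j)) (PerfectClosure S p) i) := by
  have hdom : IsDomain R := (IsRegularLocalRing.isDomain_and_exists_isWeaklyRegular R).1
  obtain ⟨B, f, g, c, hc0, hfg⟩ := exists_linearMap_finsupp_comp_eq_smul R S
  refine almostZero_cechCohomology _ v i fun a m hm ε hε => ?_
  obtain ⟨N₀, hN₀⟩ := exists_forall_pow_eq_of p m
  obtain ⟨r, hr⟩ := WithTop.ne_top_iff_exists.1 (hv c hc0)
  obtain ⟨N, hN, hlt⟩ := exists_pow_pos_lt p r ε hε N₀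
  obtain ⟨μ, hμ⟩ := hN₀ N hN
  set q : ℕ := p ^ N with hq
  have hq0 : q ≠ 0 := pow_ne_zero N (Fact.out : p.Prime).ne_zero
  let F : PerfectClosure S p →+* PerfectClosure S p := iterateFrobenius _ p N
  have hF : ∀ y, F y = y ^ q := fun y => iterateFrobenius_def p N y
  have hFbij : Function.Bijective F := bijective_iterateFrobenius (PerfectClosure S p) p N
  -- The annihilator is the `q`-th root of `c`, of value `r / q < ε` by the choice of `N`.
  obtain ⟨b, hb⟩ := (bijective_iterateFrobenius T p N).2 (algebraMap R T c)
  have hψb : ψ b ^ q = PerfectClosure.of S p (algebraMap R S c) := by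
    rw [← map_pow, hq, ← iterateFrobenius_def, hb, hR]
  have hxm : ∀ j, x j ∈ maximalIdeal R := fun j => hx ▸ Ideal.subset_span ⟨j, rfl⟩
  let X : ℕ → Fin n → PerfectClosure S p := fun k j =>
    PerfectClosure.of S p (algebraMap R S (((x ^ q) ^ k) j))
  -- Frobenius carries the Koszul complex of `x ^ k` to that of `(x ^ q) ^ k`.
  have hFk : ∀ k (w : Finset (Fin n) → PerfectClosure S p) t,
      F (koszulD ((fun j => algebraMap R T (x j)) ^ k) w t) =
        koszulD (X k) (fun s => F (w s)) t := fun k w t => by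
    refine map_koszulD F.toAddMonoidHom (fun j m => ?_) w t
    simp only [RingHom.toAddMonoidHom_eq_coe, AddMonoidHom.coe_coe, hψ, map_mul, smul_eq_mul, X,
      Pi.pow_apply, map_pow, hR]
    rw [hF (PerfectClosure.of S p _), pow_right_comm]
  have hof : ∀ k (w : Finset (Fin n) → S) t,
      PerfectClosure.of S p (koszulD ((x ^ q) ^ k) w t) =
        koszulD (X k) (fun s => PerfectClosure.of S p (w s)) t := fun k w t => by
    refine map_koszulD (PerfectClosure.of S p).toAddMonoidHom (fun j m => ?_) w t
    simp only [RingHom.toAddMonoidHom_eq_coe, AddMonoidHom.coe_coe, smul_eq_mul, X,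
      Algebra.smul_def, map_mul]
  have hcoc : ∀ t : Finset (Fin n), t.card = i + 1 →
      koszulD ((x ^ q) ^ a) (fun s => g (μ s)) t = 0 := fun t ht => by
    have h1 : koszulD ((x ^ q) ^ a) μ t = 0 := by
      apply perfectClosure_of_injective p
      simp only [hof, ← hμ, ← hF, ← hFk, hm t ht, map_zero]
    have h2 := map_koszulD (x := (x ^ q) ^ a) (y := (x ^ q) ^ a) g.toAddMonoidHom
      (fun j m => g.map_smul _ m) μ t
    simp only [LinearMap.toAddMonoidHom_coe, h1, map_zero] at h2
    exact h2.symm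
  have hrad : maximalIdeal R ≤ (Ideal.span (Set.range (x ^ q))).radical := by
    rw [← hx, Ideal.span_le]
    rintro _ ⟨j, rfl⟩
    exact ⟨q, Ideal.subset_span ⟨j, rfl⟩⟩
  obtain ⟨e, w, hw⟩ := koszulLimitVanishes_finsupp B (x := x ^ q)
    (fun j => Ideal.pow_mem_of_mem _ (hxm j) q (Nat.pos_of_ne_zero hq0)) hrad hi a _ hcoc
  -- The primitive found in the free module is mapped back to `S` and its `q`-th roots are taken;
  -- `e` is unchanged since the sequence was `x ^ q`.
  choose u hu using fun s => hFbij.2 (PerfectClosure.of S p (f (w s)))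
  refine ⟨b, v.lt_of_map_pow_lt hq0 ?_, e, u, fun s hs => hFbij.1 ?_⟩
  · rw [hq, ← iterateFrobenius_def, hb, ← hr]
    exact WithTop.coe_lt_coe.2 hlt
  · have h1 : koszulD ((x ^ q) ^ (a + e)) (fun s => f (w s)) s =
        (∏ j ∈ s, (x ^ q) j) ^ e • c • μ s := by
      have := map_koszulD (x := (x ^ q) ^ (a + e)) (y := (x ^ q) ^ (a + e)) f.toAddMonoidHom
        (fun j m => f.map_smul _ m) w s
      simp only [LinearMap.toAddMonoidHom_coe] at this
      rw [← this, ← hw s hs, map_smul, hfg]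
    simp only [hFk, hu, ← hof, h1]
    simp only [hψ, map_mul, hF, Algebra.smul_def, map_pow, map_prod, hR, Pi.pow_apply,
      Finset.prod_pow]
    rw [mul_pow, mul_pow, hψb, hμ]
    ring

/-- The elements of `𝔪` are not invertible in a ring over which `S_∞` is an algebra. -/
theorem not_isUnit_algebraMap_of_mem_maximalIdeal (hinj : Function.Injective (algebraMap R S))
    {T : Type*} [CommRing T] [Algebra R T] (ψ : T →+* PerfectClosure S p)
    (hR : ∀ r : R, ψ (algebraMap R T r) = PerfectClosure.of S p (algebraMap R S r)) {x : R}
    (hx : x ∈ maximalIdeal R) : ¬ IsUnit (algebraMap R T x) := by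
  intro h
  have h1 := h.map ψ
  rw [hR] at h1
  have hloc : IsLocalHom (algebraMap R S) :=
    (algebraMap_isIntegral_iff.2 inferInstance : (algebraMap R S).IsIntegral).isLocalHom hinj
  exact (mem_maximalIdeal _).1 hx ((isUnit_map_iff (algebraMap R S) x).1 (isUnit_of_isUnit_of p h1))

/-- A lower bound for the values of the elements of `T` that land in `𝔪 S_∞` obstructs the almost
vanishing of `S_∞ / 𝔪 S_∞`. -/
theorem not_almostZero_quotient (hinj : Function.Injective (algebraMap R S))
    {T : Type*} [CommRing T] [Algebra R T] [Module T (PerfectClosure S p)]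
    (ψ : T →+* PerfectClosure S p) (hψ : ∀ (t : T) (m : PerfectClosure S p), t • m = ψ t * m)
    (hR : ∀ r : R, ψ (algebraMap R T r) = PerfectClosure.of S p (algebraMap R S r))
    (v : ValueMap T) (hv : v.IsNormalized)
    (hbound : ∀ (n : ℕ) (x : Fin n → R) (μ : ℝ), 0 < μ →
      (∀ j, (μ : WithTop ℝ) ≤ v (algebraMap R T (x j))) → ∀ b : T,
      ψ b ∈ Ideal.span (Set.range fun j => PerfectClosure.of S p (algebraMap R S (x j))) →
      ((μ / 2 : ℝ) : WithTop ℝ) ≤ v b) :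
    ¬ AlmostZero v (PerfectClosure S p ⧸
      ((maximalIdeal R).map (algebraMap R T) • (⊤ : Submodule T (PerfectClosure S p)))) := by
  intro h
  obtain ⟨n, x, hx⟩ := Submodule.fg_iff_exists_fin_generating_family.1
    (IsNoetherian.noetherian (maximalIdeal R))
  replace hx : Ideal.span (Set.range x) = maximalIdeal R := hx
  obtain ⟨μ, hμ, hμx⟩ := v.exists_pos_forall_le (fun j => algebraMap R T (x j)) fun j =>
    hv.2 _ (not_isUnit_algebraMap_of_mem_maximalIdeal p hinj ψ hR
      (hx ▸ Ideal.subset_span ⟨j, rfl⟩))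
  -- Killing the class of `1` puts `ψ b` in `𝔪 S_∞`. Half of `μ` is given away for the error term in
  -- the case of `R_∞`.
  obtain ⟨b, hb, hvb⟩ := h (Submodule.Quotient.mk 1) (μ / 2) (half_pos hμ)
  rw [← Submodule.Quotient.mk_smul, Submodule.Quotient.mk_eq_zero, hψ, mul_one] at hb
  refine absurd hvb (not_lt.2 (hbound n x μ hμ hμx b ?_))
  refine Submodule.smul_induction_on hb (fun r hr m _ => ?_) fun _ _ => Ideal.add_mem _
  rw [hψ]
  refine Ideal.mul_mem_right _ _ ?_
  have h1 := Ideal.mem_map_of_mem ψ hr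
  rw [Ideal.map_map, ← hx, Ideal.map_span, ← Set.range_comp] at h1
  have h2 : (ψ.comp (algebraMap R T) ∘ x) =
      fun j => PerfectClosure.of S p (algebraMap R S (x j)) := funext fun j => hR (x j)
  rwa [h2] at h1

/-- Elements of `R_∞` that land in `𝔪 S_∞` have values bounded below. -/
theorem le_map_of_perfectClosureMap_mem [CharP R p] (hinj : Function.Injective (algebraMap R S))
    (v : ValueMap (PerfectClosure R p)) (hv : ∀ c, 0 ≤ v c)
    (hv' : ∀ c : R, c ≠ 0 → v (PerfectClosure.of R p c) ≠ ⊤) {n : ℕ} {x : Fin n → R}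
    {μ : ℝ} (hμ : 0 < μ) (hx : ∀ j, (μ : WithTop ℝ) ≤ v (PerfectClosure.of R p (x j)))
    {b : PerfectClosure R p}
    (hb : perfectClosureMap p R S b ∈
      Ideal.span (Set.range fun j => PerfectClosure.of S p (algebraMap R S (x j)))) :
    ((μ / 2 : ℝ) : WithTop ℝ) ≤ v b := by
  have hdom : IsDomain R := (IsRegularLocalRing.isDomain_and_exists_isWeaklyRegular R).1
  obtain ⟨B, f, g, c, hc0, hfg⟩ := exists_linearMap_finsupp_comp_eq_smul R S
  -- Since `f (g 1) = c • 1 ≠ 0`, some coordinate of `g` is a functional `h` with `h 1 ≠ 0`.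
  have hg : g 1 ≠ 0 := fun h => hc0 <| hinj <| by
    rw [map_zero, Algebra.algebraMap_eq_smul_one, ← hfg, h, map_zero]
  obtain ⟨l, hl⟩ := Finsupp.ne_iff.1 hg
  let h : S →ₗ[R] R := (Finsupp.lapply l).comp g
  have hh : h 1 ≠ 0 := hl
  obtain ⟨γ, hγ⟩ := Ideal.mem_span_range_iff_exists_fun.1 hb
  obtain ⟨N₁, hN₁⟩ := exists_forall_pow_eq_of p γ
  obtain ⟨N₂, hN₂⟩ := exists_pow_eq_of p b
  obtain ⟨r, hr⟩ := WithTop.ne_top_iff_exists.1 (hv' _ hh)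
  obtain ⟨N, hN, hlt⟩ := exists_pow_pos_lt p r (μ / 2) (half_pos hμ) (max N₁ N₂)
  obtain ⟨γ', hγ'⟩ := hN₁ N ((le_max_left _ _).trans hN)
  obtain ⟨β, hβ⟩ := hN₂ N ((le_max_right _ _).trans hN)
  set q : ℕ := p ^ N with hq
  have hq0 : q ≠ 0 := pow_ne_zero N (Fact.out : p.Prime).ne_zero
  have hmap : ∀ r : R, perfectClosureMap p R S (PerfectClosure.of R p r) =
      PerfectClosure.of S p (algebraMap R S r) := fun _ => rfl
  have hsum : algebraMap R S β = ∑ j, x j ^ q • γ' j := by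
    apply perfectClosure_of_injective p
    rw [← hmap, ← hβ, map_pow, ← hγ, hq, sum_pow_char_pow, map_sum]
    refine Finset.sum_congr rfl fun j _ => ?_
    rw [Algebra.smul_def, map_mul, ← hγ', mul_pow, map_pow, map_pow, mul_comm]
  have hmul : β * h 1 = ∑ j, x j ^ q * h (γ' j) := by
    have := congrArg h hsum
    rwa [Algebra.algebraMap_eq_smul_one, map_smul, smul_eq_mul, map_sum,
      Finset.sum_congr rfl fun j _ => by rw [map_smul, smul_eq_mul]] at this
  by_contra! hc
  have hle : ((q * μ : ℝ) : WithTop ℝ) ≤ v (PerfectClosure.of R p (β * h 1)) := by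
    refine v.le_of_mem_span hv (y := fun j => PerfectClosure.of R p (x j) ^ q) (fun j => ?_) ?_
    · rw [v.map_pow _ hq0, ← nsmul_eq_mul, WithTop.coe_nsmul]
      exact nsmul_le_nsmul_right (hx j) q
    · rw [hmul, map_sum]
      refine Ideal.sum_mem _ fun j _ => ?_
      rw [map_mul, map_pow]
      exact Ideal.mul_mem_right _ _ (Ideal.subset_span ⟨j, rfl⟩)
  -- Now `q * μ ≤ q * v b + v (h 1)`, while both summands are below `q * μ / 2`.
  obtain ⟨r', hr'⟩ := WithTop.ne_top_iff_exists.1 hc.ne_top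
  rw [← hr', WithTop.coe_lt_coe] at hc
  rw [map_mul, v.map_mul', ← hβ, v.map_pow _ hq0, ← hr, ← hr', ← WithTop.coe_nsmul,
    ← WithTop.coe_add, WithTop.coe_le_coe, nsmul_eq_mul] at hle
  have : (0 : ℝ) < q := by exact_mod_cast Nat.pos_of_ne_zero hq0
  nlinarith

end Main

end AlmostCM

theorem corollary6p10 (p : ℕ) [Fact p.Prime] (R S : Type*)
    [CommRing R] [IsRegularLocalRing R] [CharP R p]
    [CommRing S] [IsLocalRing S] [IsReduced S] [CharP S p]
    [Algebra R S] [Module.Finite R S]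
    (hinj : Function.Injective (algebraMap R S)) :
    (∀ v : AlmostCM.ValueMap (PerfectClosure S p), v.IsNormalized →
      (∀ c : R, c ≠ 0 → v (algebraMap R (PerfectClosure S p) c) ≠ ⊤) →
      AlmostCM.IsAlmostCohenMacaulay R v (PerfectClosure S p)) ∧
    (∀ v : AlmostCM.ValueMap (PerfectClosure R p), v.IsNormalized →
      (∀ c : R, c ≠ 0 → v (algebraMap R (PerfectClosure R p) c) ≠ ⊤) →
      letI : Module (PerfectClosure R p) (PerfectClosure S p) :=
        AlmostCM.perfectClosureModule p R S
      AlmostCM.IsAlmostCohenMacaulay R v (PerfectClosure S p)) := by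
  refine ⟨fun v hv hv' => ⟨fun n x hx i hi => ?_, ?_⟩, fun v hv hv' => ?_⟩
  · exact AlmostCM.almostZero_cechCohomology_perfectClosure p (RingHom.id _) (fun _ _ => rfl)
      (fun _ => rfl) v hv' hx hi
  · refine AlmostCM.not_almostZero_quotient p hinj (RingHom.id _) (fun _ _ => rfl)
      (fun _ => rfl) v hv fun n x μ hμ hx b hb => ?_
    exact (WithTop.coe_le_coe.2 (half_le_self hμ.le)).trans (v.le_of_mem_span hv.1 hx hb)
  · let : Module (PerfectClosure R p) (PerfectClosure S p) := AlmostCM.perfectClosureModule p R S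
    refine ⟨fun n x hx i hi => ?_, ?_⟩
    · exact AlmostCM.almostZero_cechCohomology_perfectClosure p (AlmostCM.perfectClosureMap p R S)
        (fun _ _ => rfl) (fun _ => rfl) v hv' hx hi
    · exact AlmostCM.not_almostZero_quotient p hinj (AlmostCM.perfectClosureMap p R S)
        (fun _ _ => rfl) (fun _ => rfl) v hv fun n x μ hμ hx b hb =>
          AlmostCM.le_map_of_perfectClosureMap_mem p hinj v hv.1 hv' hμ hx hb
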